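/- Let $\mathbf F$ be a field of characteristic $2$ and $m\ge 0$. Let $C_2=\langle\sigma\rangle$ act on $\mathbf F[mV_2]=\mathbf F[x_1,y_1,\dots,x_m,y_m]$ by $\sigma(x_i)=x_i$, $\sigma(y_i)=y_i+x_i$. For $A\subseteq\{1,\dots,m\}$ put $\operatorname{tr}(A)=\prod_{i\in A}y_i+\prod_{i\in A}(y_i+x_i)$, and put $N_i=y_i^2+x_iy_i$. Let $R=\mathbf F[x_1,\dots,x_m,N_1,\dots,N_m]$, let $Q=R[\operatorname{Tr}(A) : A\subseteq\{1,\dots,m\},\ |A|\ge 2]$ be the polynomial ring in the indicated independent variables $x_i$, $N_i$, $\operatorname{Tr}(A)$, and let $\pi:Q\to\mathbf F[mV_2]^{C_2}$ be the $\mathbf F$-algebra map with $\pi(x_i)=x_i$, $\pi(N_i)=y_i^2+x_iy_i$, $\pi(\operatorname{Tr}(A))=\operatorname{tr}(A)$. In $Q$ write also $\operatorname{Tr}(\{i\})=x_i$, $\operatorname{Tr}(\emptyset)=0$, $x^A=\prod_{i\in A}x_i$, $N^A=\prod_{i\in A}N_i$. The relation of type I associated to $A$ with $|A|\ge 3$ is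 $\sum_{\emptyset\ne L\subsetneq A}x^{A\setminus L}\operatorname{Tr}(L)$. For $|A|,|B|\ge 2$ the relations of type III are the following. * (a) If $A\cap B=\emptyset$, for $j\in B$ and $B'=B\setminus\{j\}$: $$\operatorname{Tr}(A)\operatorname{Tr}(B)+\operatorname{Tr}(A\cup\{j\})\operatorname{Tr}(B')+x_j\operatorname{Tr}(A\cup B')+x_j\operatorname{Tr}(A)\operatorname{Tr}(B').$$ * (b) If $A\cap B\neq\emptyset$ and $B\subseteq A$, for $i\in B$, $A'=A\setminus\{i\}$, $B'=B\setminus\{i\}$, $J=A\setminus B$: $$\operatorname{Tr}(A)\operatorname{Tr}(B)+x_i\operatorname{Tr}(A)\operatorname{Tr}(B')+N_i\operatorname{Tr}(A')\operatorname{Tr}(B')+x_iN^{B'}\operatorname{Tr}(J\cup\{i\}).$$ * (c) If $A\cap B\neq\emptyset$, $A\not\subseteq B$, $B\not\subseteq A$, with $I=A\cap B$, $J=A\setminus B$, $K=B\setminus A$: $$\operatorname{Tr}(A)\operatorname{Tr}(B)+\operatorname{Tr}(I\cup J\cup K)\operatorname{Tr}(I)+N^I\operatorname{Tr}(J)\operatorname{Tr}(K).$$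 A linear relation is an element of $\ker\pi$ of the form $f_0+\sum_{|C|\ge2}f_C\operatorname{Tr}(C)$, and a quadratic relation is an element of $\ker\pi$ of the form $\operatorname{Tr}(A)\operatorname{Tr}(B)+f_0+\sum_{|C|\ge2}f_C\operatorname{Tr}(C)$ with $|A|,|B|\ge2$, where all $f_0,f_C\in R$. A set $T\subseteq\ker\pi$ is said to generate the quadratic relations if every quadratic relation is the sum of an element of the ideal $(T)$ and a linear relation. **Theorem.** For every unordered pair $\{A,B\}$ of subsets of $\{1,\dots,m\}$ with $|A|,|B|\ge 2$ ($A=B$ allowed), choose one relation of type III as follows: if $A\cap B=\emptyset$, order the pair so that $|A|\ge|B|$ and choose a relation of type (a); if one of the two sets contains the other, order the pair so that $B\subseteq A$ and choose a relation of type (b); otherwise take the relation of type (c). Let $T$ be the set of the chosen relations. Then 1. $T$ minimally generates the quadratic relations: $T$ generates the quadratic relations and no proper subset of $T$ does; 2. $T$ together with the set of all relations of type I minimally generates the ideal $\ker\pi$: it generates $\ker\pi$ and no proper subset of it does. -/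

import Mathlib

noncomputable section

open MvPolynomial

namespace VectorInvariants

/-! ### The representation `m V₂` of `C₂` and its ring of invariants -/

/-- The coordinate functions on `m V₂`: `x₁, y₁, …, x_m, y_m`. -/
inductive Coord (m : ℕ) : Type
  | x (i : Fin m) : Coord m
  | y (i : Fin m) : Coord m

/-- The polynomial ring `F[m V₂] = F[x₁, y₁, …, x_m, y_m]`. -/
abbrev CoordRing (F : Type*) [Field F] (m : ℕ) : Type _ := MvPolynomial (Coord m) F

/-- The action of the generator `σ` of `C₂`: `σ xᵢ = xᵢ` and `σ yᵢ = yᵢ + xᵢ`. -/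
def sigma (F : Type*) [Field F] (m : ℕ) : CoordRing F m →ₐ[F] CoordRing F m :=
  aeval fun c => match c with
    | Coord.x i => X (Coord.x i)
    | Coord.y i => X (Coord.y i) + X (Coord.x i)

/-- The ring of invariants `F[m V₂]^{C₂}`: the polynomials fixed by `σ`. -/
def invariants (F : Type*) [Field F] (m : ℕ) : Subalgebra F (CoordRing F m) :=
  AlgHom.equalizer (sigma F m) (AlgHom.id F (CoordRing F m))

/-- The norm `Nᵢ = yᵢ² + xᵢ yᵢ`. -/
def norm (F : Type*) [Field F] {m : ℕ} (i : Fin m) : CoordRing F m :=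
  X (Coord.y i) ^ 2 + X (Coord.x i) * X (Coord.y i)

/-- The trace `tr(A) = y^A + ∏_{i ∈ A} (yᵢ + xᵢ)` of the monomial `y^A`. -/
def tr (F : Type*) [Field F] {m : ℕ} (A : Finset (Fin m)) : CoordRing F m :=
  (∏ i ∈ A, X (Coord.y i)) + ∏ i ∈ A, (X (Coord.y i) + X (Coord.x i))

theorem x_mem_invariants (F : Type*) [Field F] {m : ℕ} (i : Fin m) :
    (X (Coord.x i) : CoordRing F m) ∈ invariants F m := by
  simp [invariants, AlgHom.mem_equalizer, sigma]

theorem norm_mem_invariants (F : Type*) [Field F] [CharP F 2] {m : ℕ} (i : Fin m) :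
    norm F i ∈ invariants F m := by
  have h2 : (2 : CoordRing F m) = 0 := CharTwo.two_eq_zero
  simp only [invariants, AlgHom.mem_equalizer, sigma, norm, map_add, map_mul, map_pow, aeval_X,
    AlgHom.id_apply]
  linear_combination
    (X (Coord.x i) * X (Coord.y i) + X (Coord.x i) ^ 2 : CoordRing F m) * h2

theorem tr_mem_invariants (F : Type*) [Field F] [CharP F 2] {m : ℕ} (A : Finset (Fin m)) :
    tr F A ∈ invariants F m := by
  have h : ∀ i : Fin m, (X (Coord.y i) + X (Coord.x i) + X (Coord.x i) : CoordRing F m)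
      = X (Coord.y i) := fun i => by rw [add_assoc, CharTwo.add_self_eq_zero, add_zero]
  simp only [invariants, AlgHom.mem_equalizer, sigma, tr, map_add, map_prod, aeval_X,
    AlgHom.id_apply, h]
  exact add_comm _ _

/-! ### The presentation `π : Q → F[m V₂]^{C₂}` -/

/-- The generators of the polynomial ring `Q`: symbols `xᵢ`, `Nᵢ` and `Tr(A)` for `|A| ≥ 2`. -/
inductive Gen (m : ℕ) : Type
  | x (i : Fin m) : Gen m
  | N (i : Fin m) : Gen m
  | Tr (A : {A : Finset (Fin m) // 2 ≤ A.card}) : Gen m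

/-- The polynomial ring `Q = R[Tr(A) : |A| ≥ 2]`, with `R = F[x₁, …, x_m, N₁, …, N_m]`. -/
abbrev Q (F : Type*) [Field F] (m : ℕ) : Type _ := MvPolynomial (Gen m) F

/-- The map `π` from `Q` to the ring of invariants, sending `xᵢ`, `Nᵢ`, `Tr(A)` to
`xᵢ`, `yᵢ² + xᵢ yᵢ`, `tr(A)`. -/
def pi (F : Type*) [Field F] [CharP F 2] (m : ℕ) : Q F m →ₐ[F] invariants F m :=
  aeval fun g => match g with
    | Gen.x i => ⟨X (Coord.x i), x_mem_invariants F i⟩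
    | Gen.N i => ⟨norm F i, norm_mem_invariants F i⟩
    | Gen.Tr A => ⟨tr F A.1, tr_mem_invariants F A.1⟩

/-- `ker π`, the ideal of relations. -/
def relations (F : Type*) [Field F] [CharP F 2] (m : ℕ) : Ideal (Q F m) :=
  RingHom.ker (pi F m)

/-- The element `xᵢ` of `Q`. -/
def x (F : Type*) [Field F] {m : ℕ} (i : Fin m) : Q F m := X (Gen.x i)

/-- The element `Nᵢ` of `Q`. -/
def N (F : Type*) [Field F] {m : ℕ} (i : Fin m) : Q F m := X (Gen.N i)

/-- The element `Tr(A)` of `Q` for an arbitrary `A`: the generator `Tr(A)` if `|A| ≥ 2`;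
since `tr({i}) = xᵢ` and `tr(∅) = 0`, `Tr({i})` means `xᵢ` and `Tr(∅)` means `0`
(the sum below has one term, respectively none). -/
def Tr (F : Type*) [Field F] {m : ℕ} (A : Finset (Fin m)) : Q F m :=
  if h : 2 ≤ A.card then X (Gen.Tr ⟨A, h⟩) else ∑ i ∈ A, x F i

/-- `x^A`. -/
def xPow (F : Type*) [Field F] {m : ℕ} (A : Finset (Fin m)) : Q F m := ∏ i ∈ A, x F i

/-- `N^A`. -/
def NPow (F : Type*) [Field F] {m : ℕ} (A : Finset (Fin m)) : Q F m := ∏ i ∈ A, N F i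

/-! ### Relations of types I and III -/

/-- The relation of type I associated to `A`: `∑_{∅ < L < A} x^{A - L} Tr(L)`. -/
def typeI (F : Type*) [Field F] {m : ℕ} (A : Finset (Fin m)) : Q F m :=
  ∑ L ∈ A.ssubsets with L.Nonempty, xPow F (A \ L) * Tr F L

/-- The set of all relations of type I, one for every `A` with `|A| ≥ 3`. -/
def typeISet (F : Type*) [Field F] (m : ℕ) : Set (Q F m) :=
  {q | ∃ A : Finset (Fin m), 3 ≤ A.card ∧ q = typeI F A}

/-- Type III (a), for `A ∩ B = ∅` and `j ∈ B`; here `B' = B - Δ_j`. -/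
def typeIIIa (F : Type*) [Field F] {m : ℕ} (A B : Finset (Fin m)) (j : Fin m) : Q F m :=
  Tr F A * Tr F B + Tr F (insert j A) * Tr F (B.erase j) + x F j * Tr F (A ∪ B.erase j)
    + x F j * Tr F A * Tr F (B.erase j)

/-- Type III (b), for `B ⊆ A` and `i ∈ B`; here `A' = A - Δ_i`, `B' = B - Δ_i`, `J = A \ B`. -/
def typeIIIb (F : Type*) [Field F] {m : ℕ} (A B : Finset (Fin m)) (i : Fin m) : Q F m :=
  Tr F A * Tr F B + x F i * Tr F A * Tr F (B.erase i)
    + N F i * Tr F (A.erase i) * Tr F (B.erase i)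
    + x F i * NPow F (B.erase i) * Tr F (insert i (A \ B))

/-- Type III (c), for `A ∩ B ≠ ∅`, `A ⊈ B`, `B ⊈ A`; here `I = A ∩ B`, `J = A \ B`, `K = B \ A`
and `I + J + K = A ∪ B`. -/
def typeIIIc (F : Type*) [Field F] {m : ℕ} (A B : Finset (Fin m)) : Q F m :=
  Tr F A * Tr F B + Tr F (A ∪ B) * Tr F (A ∩ B) + NPow F (A ∩ B) * Tr F (A \ B) * Tr F (B \ A)

/-- `q` is a relation of type III that may be chosen for the pair `A, B` taken in this order:
of type (a) if `A`, `B` are disjoint and `|A| ≥ |B|`, of type (b) if they meet and `B ⊆ A`,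
of type (c) if they meet and neither contains the other. -/
inductive IsTypeIII {F : Type*} [Field F] {m : ℕ} (A B : Finset (Fin m)) : Q F m → Prop
  | a (j : Fin m) (hAB : A ∩ B = ∅) (hcard : B.card ≤ A.card) (hj : j ∈ B) :
      IsTypeIII A B (typeIIIa F A B j)
  | b (i : Fin m) (hAB : (A ∩ B).Nonempty) (hBA : B ⊆ A) (hi : i ∈ A ∩ B) :
      IsTypeIII A B (typeIIIb F A B i)
  | c (hAB : (A ∩ B).Nonempty) (hA : ¬ A ⊆ B) (hB : ¬ B ⊆ A) :
      IsTypeIII A B (typeIIIc F A B)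

/-- A choice of one admissible relation of type III for every unordered pair `{A, B}`
(`A = B` allowed) with `|A|, |B| ≥ 2`, the two sets being interchanged if necessary. -/
def IsChoice {F : Type*} [Field F] {m : ℕ}
    (r : Sym2 {A : Finset (Fin m) // 2 ≤ A.card} → Q F m) : Prop :=
  ∀ p, ∃ A B : {A : Finset (Fin m) // 2 ≤ A.card}, p = s(A, B) ∧ IsTypeIII A.1 B.1 (r p)

/-! ### Linear and quadratic relations, minimal generation -/

/-- The subring `R = F[x₁, …, x_m, N₁, …, N_m]` of `Q`. -/
def R (F : Type*) [Field F] (m : ℕ) : Subalgebra F (Q F m) :=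
  Algebra.adjoin F (Set.range (x F (m := m)) ∪ Set.range (N F (m := m)))

/-- The elements `f₀ + ∑_{|C| ≥ 2} f_C Tr(C)` of `Q`, all coefficients in `R`. -/
def linearForms (F : Type*) [Field F] (m : ℕ) : Submodule (R F m) (Q F m) :=
  Submodule.span (R F m) ({1} ∪ {q | ∃ C : Finset (Fin m), 2 ≤ C.card ∧ q = Tr F C})

/-- The `R`-module of linear relations. -/
def linearRelations (F : Type*) [Field F] [CharP F 2] (m : ℕ) : Submodule (R F m) (Q F m) :=
  linearForms F m ⊓ (relations F m).restrictScalars (R F m)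

/-- The quadratic relations: the elements `Tr(A) Tr(B) + f₀ + ∑ f_C Tr(C)` of `ker π`,
with `|A|, |B| ≥ 2` and coefficients in `R`. -/
def quadraticRelations (F : Type*) [Field F] [CharP F 2] (m : ℕ) : Set (Q F m) :=
  {h | h ∈ relations F m ∧ ∃ A B : Finset (Fin m), 2 ≤ A.card ∧ 2 ≤ B.card ∧
    h - Tr F A * Tr F B ∈ linearForms F m}

/-- A set `T` of relations generates the quadratic relations: every quadratic relation is the sum
of an element of the ideal generated by `T` and of a linear relation. -/
def GeneratesQuadratic {F : Type*} [Field F] [CharP F 2] {m : ℕ} (T : Set (Q F m)) : Prop :=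
  T ⊆ relations F m ∧
    quadraticRelations F m ⊆
      ((Ideal.span T).restrictScalars (R F m) ⊔ linearRelations F m : Submodule (R F m) (Q F m))

/-- `T` generates the quadratic relations and no proper subset of `T` does. -/
def MinimallyGeneratesQuadratic {F : Type*} [Field F] [CharP F 2] {m : ℕ}
    (T : Set (Q F m)) : Prop :=
  GeneratesQuadratic T ∧ ∀ T' : Set (Q F m), T' ⊂ T → ¬ GeneratesQuadratic T'

/-- `S` generates the ideal `I` and no proper subset of `S` does. -/
def MinimallyGenerates {P : Type*} [CommRing P] (S : Set P) (I : Ideal P) : Prop :=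
  Ideal.span S = I ∧ ∀ S' : Set P, S' ⊂ S → Ideal.span S' ≠ I

end VectorInvariants

end

/-!
Write `z_i = y_i + x_i`, so that `tr(A) = y^A + z^A`, `N_i = y_i z_i` and, in characteristic `2`,
`x_i = y_i + z_i`; with these substitutions the relations of types I and III become polynomial
identities modulo `2`.

*Generation.* A relation of type III rewrites `Tr(A) Tr(B)` in terms of products `Tr(C) Tr(D)` with
`min |C| |D| < min |A| |B|`. Hence every element of `Q` is congruent, modulo the ideal of the chosen
relations, to a linear form `f₀ + ∑ f_C Tr(C)` (`IsChoice.reducible_eq_top`), and `ker π` is the sum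
of that ideal and the module of linear relations. For the latter, the ring `F[m V₂]` has the
monomials `y^L` as independent elements over `F[x₁, …, x_m, N₁, …, N_m]` (`yPow_independent`), and
comparing coefficients of `y^L` shows that the coefficients `f_C` with `|C|` maximal form a cycle in
the Koszul complex of `x₁, …, x_m`. That complex is exact (`exists_eq_koszul`), and the Koszul
boundaries are exactly the leading parts of combinations of relations of type I, so a descending
induction on the size of the sets `C` reduces a linear relation to `0` (`mem_span_typeI`).

*Minimality.* All the relations have terms of degree at least `2` only, as polynomials in the
variables of `Q`. If one of them is in the ideal generated by the others, then its quadratic part is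
a linear combination over `F` of their quadratic parts. But these quadratic parts are linearly
independent (`IsChoice.notMem_span`): the quadratic part of a relation of type III is
`Tr(A) Tr(B)` plus products `Tr(C) Tr(D)` with a smaller `min` and multiples of the `x_i`, and that
of a relation of type I is `∑ x_i Tr(A - i)`. Finally, a set `T'` of relations which
generates the quadratic ones again reduces all of `Q` to linear forms, so that `T'` and the
relations of type I generate `ker π`; this carries minimality over to the quadratic relations.
-/

noncomputable section

open MvPolynomial

namespace VectorInvariants

variable {F : Type*} [Field F] {m : ℕ}

/-! ### The relations hold -/

section

/-- `σ(y^A) = ∏_{i ∈ A} (yᵢ + xᵢ)`. -/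
def zPow (F : Type*) [Field F] {m : ℕ} (A : Finset (Fin m)) : CoordRing F m :=
  ∏ i ∈ A, (X (Coord.y i) + X (Coord.x i))

/-- The monomial `y^A`. -/
def yPow (F : Type*) [Field F] {m : ℕ} (A : Finset (Fin m)) : CoordRing F m :=
  ∏ i ∈ A, X (Coord.y i)

theorem tr_eq (A : Finset (Fin m)) : tr F A = yPow F A + zPow F A := rfl

theorem yPow_insert {A : Finset (Fin m)} {i : Fin m} (h : i ∉ A) :
    yPow F (insert i A) = X (Coord.y i) * yPow F A :=
  Finset.prod_insert h

theorem zPow_insert {A : Finset (Fin m)} {i : Fin m} (h : i ∉ A) :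
    zPow F (insert i A) = (X (Coord.y i) + X (Coord.x i)) * zPow F A :=
  Finset.prod_insert h

theorem yPow_union {A B : Finset (Fin m)} (h : Disjoint A B) :
    yPow F (A ∪ B) = yPow F A * yPow F B :=
  Finset.prod_union h

theorem zPow_union {A B : Finset (Fin m)} (h : Disjoint A B) :
    zPow F (A ∪ B) = zPow F A * zPow F B :=
  Finset.prod_union h

theorem norm_eq (i : Fin m) :
    norm F i = X (Coord.y i) * (X (Coord.y i) + X (Coord.x i)) := by
  rw [norm]; ring

theorem prod_norm (A : Finset (Fin m)) : ∏ i ∈ A, norm F i = yPow F A * zPow F A := by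
  simp_rw [norm_eq, Finset.prod_mul_distrib, yPow, zPow]

theorem Tr_empty : Tr F (∅ : Finset (Fin m)) = 0 := by
  simp [Tr]

theorem Tr_singleton (i : Fin m) : Tr F {i} = x F i := by
  simp [Tr]

variable [CharP F 2]

variable (F m) in
theorem two_eq_zero_coordRing : (2 : CoordRing F m) = 0 := CharTwo.two_eq_zero

/-- The map `π`, viewed as taking values in `F[m V₂]`. -/
def piVal (F : Type*) [Field F] [CharP F 2] (m : ℕ) : Q F m →ₐ[F] CoordRing F m :=
  (invariants F m).val.comp (pi F m)

theorem mem_relations {q : Q F m} : q ∈ relations F m ↔ piVal F m q = 0 := by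
  simp [relations, piVal, RingHom.mem_ker]

@[simp]
theorem piVal_x (i : Fin m) : piVal F m (x F i) = X (Coord.x i) := by
  simp [piVal, pi, x]

@[simp]
theorem piVal_N (i : Fin m) : piVal F m (N F i) = norm F i := by
  simp [piVal, pi, N]

theorem tr_singleton (i : Fin m) : tr F {i} = X (Coord.x i) := by
  simp only [tr, Finset.prod_singleton]
  linear_combination (X (Coord.y i) : CoordRing F m) * two_eq_zero_coordRing F m

@[simp]
theorem piVal_Tr (A : Finset (Fin m)) : piVal F m (Tr F A) = tr F A := by
  by_cases h : 2 ≤ A.card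
  · simp [piVal, pi, Tr, h]
  · obtain h | h : A.card = 0 ∨ A.card = 1 := by omega
    · obtain rfl := Finset.card_eq_zero.1 h
      simpa [Tr_empty, tr] using (CharTwo.add_self_eq_zero (1 : CoordRing F m)).symm
    · obtain ⟨i, rfl⟩ := Finset.card_eq_one.1 h
      rw [Tr_singleton, piVal_x, tr_singleton]

theorem X_x_eq (i : Fin m) : (X (Coord.x i) : CoordRing F m) =
    X (Coord.y i) + (X (Coord.y i) + X (Coord.x i)) := by
  linear_combination -(X (Coord.y i) : CoordRing F m) * two_eq_zero_coordRing F m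

theorem typeIIIa_mem {A B : Finset (Fin m)} {j : Fin m} (h : A ∩ B = ∅) (hj : j ∈ B) :
    typeIIIa F A B j ∈ relations F m := by
  obtain ⟨B', hjB, rfl⟩ : ∃ B', j ∉ B' ∧ B = insert j B' :=
    ⟨B.erase j, Finset.notMem_erase j B, (Finset.insert_erase hj).symm⟩
  have hd := Finset.disjoint_iff_inter_eq_empty.2 h
  obtain ⟨hjA, hAB⟩ := Finset.disjoint_insert_right.1 hd
  rw [mem_relations, typeIIIa, Finset.erase_insert hjB]
  simp only [map_add, map_mul, piVal_Tr, piVal_x, tr_eq, yPow_insert hjB, zPow_insert hjB,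
    yPow_insert hjA, zPow_insert hjA, yPow_union hAB, zPow_union hAB]
  have hx := X_x_eq (F := F) j
  have h2 := two_eq_zero_coordRing F m
  generalize (X (Coord.y j) + X (Coord.x j) : CoordRing F m) = b at *
  generalize (X (Coord.y j) : CoordRing F m) = a at *
  generalize yPow F A = u, zPow F A = v, yPow F B' = p, zPow F B' = q
  rw [hx]
  linear_combination (2*a*u*p + a*u*q + a*v*p + a*v*q + b*u*p + b*u*q + b*v*p + 2*b*v*q) * h2

theorem typeIIIb_mem {A B : Finset (Fin m)} {i : Fin m} (hBA : B ⊆ A) (hi : i ∈ B) :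
    typeIIIb F A B i ∈ relations F m := by
  obtain ⟨B', hiB, rfl⟩ : ∃ B', i ∉ B' ∧ B = insert i B' :=
    ⟨B.erase i, Finset.notMem_erase i B, (Finset.insert_erase hi).symm⟩
  obtain ⟨J, hJ, rfl⟩ : ∃ J, Disjoint (insert i B') J ∧ A = insert i B' ∪ J :=
    ⟨A \ insert i B', Finset.disjoint_sdiff, (Finset.union_sdiff_of_subset hBA).symm⟩
  obtain ⟨hiJ, hBJ⟩ := Finset.disjoint_insert_left.1 hJ
  have hi' : i ∉ B' ∪ J := by simp [hiB, hiJ]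
  rw [mem_relations, typeIIIb, Finset.erase_insert hiB, Finset.union_sdiff_cancel_left hJ,
    Finset.insert_union, Finset.erase_insert hi']
  simp only [map_add, map_mul, map_prod, NPow, piVal_Tr, piVal_x, piVal_N, prod_norm, norm_eq i,
    tr_eq, yPow_insert hiB, zPow_insert hiB, yPow_insert hi', zPow_insert hi', yPow_insert hiJ,
    zPow_insert hiJ, yPow_union hBJ, zPow_union hBJ]
  have hx := X_x_eq (F := F) i
  have h2 := two_eq_zero_coordRing F m
  generalize (X (Coord.y i) + X (Coord.x i) : CoordRing F m) = b at *
  generalize (X (Coord.y i) : CoordRing F m) = a at *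
  generalize yPow F J = u, zPow F J = v, yPow F B' = p, zPow F B' = q
  rw [hx]
  linear_combination (a^2*p^2*u + 2*a*b*p*q*u + 2*a*b*p*q*v + b^2*q^2*v + a^2*p*q*u + a*b*q^2*v
    + a*b*p^2*u + b^2*p*q*v) * h2

theorem typeIIIc_mem (A B : Finset (Fin m)) : typeIIIc F A B ∈ relations F m := by
  have hA : Disjoint (A ∩ B) (A \ B) := Finset.disjoint_left.2 (by simp; tauto)
  have hB : Disjoint (A ∩ B) (B \ A) := Finset.disjoint_left.2 (by simp; tauto)
  have hAB : Disjoint A (B \ A) := Finset.disjoint_sdiff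
  have eA : A = A ∩ B ∪ A \ B := by ext; simp; tauto
  have eB : B = A ∩ B ∪ B \ A := by ext; simp; tauto
  have e1 : yPow F A = yPow F (A ∩ B) * yPow F (A \ B) := by rw [← yPow_union hA, ← eA]
  have e2 : zPow F A = zPow F (A ∩ B) * zPow F (A \ B) := by rw [← zPow_union hA, ← eA]
  have e3 : yPow F B = yPow F (A ∩ B) * yPow F (B \ A) := by rw [← yPow_union hB, ← eB]
  have e4 : zPow F B = zPow F (A ∩ B) * zPow F (B \ A) := by rw [← zPow_union hB, ← eB]
  have e5 : yPow F (A ∪ B) = yPow F A * yPow F (B \ A) := by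
    rw [← yPow_union hAB, Finset.union_sdiff_self_eq_union]
  have e6 : zPow F (A ∪ B) = zPow F A * zPow F (B \ A) := by
    rw [← zPow_union hAB, Finset.union_sdiff_self_eq_union]
  rw [mem_relations, typeIIIc]
  simp only [map_add, map_mul, map_prod, NPow, piVal_Tr, piVal_N, prod_norm, tr_eq, e5, e6, e1, e2,
    e3, e4]
  have h2 := two_eq_zero_coordRing F m
  generalize yPow F (A ∩ B) = yI, zPow F (A ∩ B) = zI, yPow F (A \ B) = yJ, zPow F (A \ B) = zJ,
    yPow F (B \ A) = yK, zPow F (B \ A) = zK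
  linear_combination (yI^2*yJ*yK + zI^2*zJ*zK + yI*zI*(yJ+zJ)*(yK+zK)) * h2

theorem IsTypeIII.mem_relations {A B : Finset (Fin m)} {q : Q F m} (h : IsTypeIII A B q) :
    q ∈ relations F m := by
  cases h with
  | a j hAB _ hj => exact typeIIIa_mem hAB hj
  | b i _ hBA hi => exact typeIIIb_mem hBA (Finset.mem_inter.1 hi).2
  | c => exact typeIIIc_mem A B

/-- Expanding `z^A = ∏ (yᵢ + xᵢ)` and `y^A = ∏ (zᵢ + xᵢ)` gives
`tr(A) = ∑_{L ⊆ A} x^{A - L} tr(L)`; the term for `L = A` cancels and the one for `L = ∅` is `0`. -/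
theorem typeI_mem (A : Finset (Fin m)) : typeI F A ∈ relations F m := by
  have h2 := two_eq_zero_coordRing F m
  have hz : zPow F A = ∑ L ∈ A.powerset, yPow F L * ∏ i ∈ A \ L, X (Coord.x i) :=
    Finset.prod_add _ _ _
  have hy : yPow F A = ∑ L ∈ A.powerset, zPow F L * ∏ i ∈ A \ L, X (Coord.x i) := by
    simp_rw [zPow, ← Finset.prod_add, yPow, add_assoc, CharTwo.add_self_eq_zero, add_zero]
  have htr : tr F A = ∑ L ∈ A.powerset, (∏ i ∈ A \ L, X (Coord.x i)) * tr F L := by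
    rw [tr_eq, add_comm, hz, hy, ← Finset.sum_add_distrib]
    exact Finset.sum_congr rfl fun L _ => by rw [tr_eq]; ring
  rw [mem_relations, typeI, Finset.sum_filter, map_sum]
  rw [← Finset.add_sum_erase _ _ (Finset.mem_powerset_self A)] at htr
  rw [Finset.sdiff_self, Finset.prod_empty, one_mul, left_eq_add] at htr
  rw [← htr, Finset.ssubsets]
  refine Finset.sum_congr rfl fun L _ => ?_
  split_ifs with hL
  · simp [xPow, map_prod]
  · obtain rfl := Finset.not_nonempty_iff_eq_empty.1 hL
    simp [← piVal_Tr, Tr_empty]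

end

/-! ### Reduction to linear forms -/

section

theorem x_mem_R (i : Fin m) : x F i ∈ R F m :=
  Algebra.subset_adjoin (Or.inl ⟨i, rfl⟩)

theorem N_mem_R (i : Fin m) : N F i ∈ R F m :=
  Algebra.subset_adjoin (Or.inr ⟨i, rfl⟩)

theorem NPow_mem_R (A : Finset (Fin m)) : NPow F A ∈ R F m :=
  prod_mem fun i _ => N_mem_R i

theorem mul_mem_of_mem_R {W : Submodule (R F m) (Q F m)} {a q : Q F m} (ha : a ∈ R F m)
    (hq : q ∈ W) : a * q ∈ W :=
  W.smul_mem ⟨a, ha⟩ hq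

theorem one_mem_linearForms : (1 : Q F m) ∈ linearForms F m :=
  Submodule.subset_span (Or.inl rfl)

theorem Tr_mem_linearForms (A : Finset (Fin m)) : Tr F A ∈ linearForms F m := by
  by_cases h : 2 ≤ A.card
  · exact Submodule.subset_span (Or.inr ⟨A, h, rfl⟩)
  · rw [Tr, dif_neg h]
    exact sum_mem fun i _ => by simpa using mul_mem_of_mem_R (x_mem_R i) one_mem_linearForms

theorem Tr_mem_R {A : Finset (Fin m)} (h : ¬ 2 ≤ A.card) : Tr F A ∈ R F m := by
  rw [Tr, dif_neg h]
  exact sum_mem fun i _ => x_mem_R i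

/-- The `R`-module of polynomials congruent to a linear form modulo the ideal `(T)`. -/
def reducible (T : Set (Q F m)) : Submodule (R F m) (Q F m) :=
  (Ideal.span T).restrictScalars (R F m) ⊔ linearForms F m

theorem linearForms_le_reducible (T : Set (Q F m)) : linearForms F m ≤ reducible T :=
  le_sup_right

theorem mem_reducible_of_mem {T : Set (Q F m)} {q : Q F m} (h : q ∈ Ideal.span T) :
    q ∈ reducible T :=
  Submodule.mem_sup_left h

/-- If all products `Tr(A) Tr(B)` reduce to linear forms modulo `(T)`, so does every element
of `Q`. -/
theorem reducible_eq_top {T : Set (Q F m)}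
    (hT : ∀ A B : Finset (Fin m), 2 ≤ A.card → 2 ≤ B.card → Tr F A * Tr F B ∈ reducible T) :
    reducible T = ⊤ := by
  have hTr : ∀ A : Finset (Fin m), 2 ≤ A.card → ∀ q ∈ reducible T, q * Tr F A ∈ reducible T := by
    intro A hA q hq
    obtain ⟨t, ht, l, hl, rfl⟩ := Submodule.mem_sup.1 hq
    rw [add_mul]
    refine add_mem (mem_reducible_of_mem (Ideal.mul_mem_right _ _ ht)) ?_
    clear hq
    induction hl using Submodule.span_induction with
    | mem l hl =>
      obtain rfl | ⟨C, hC, rfl⟩ := hl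
      · rw [one_mul]
        exact linearForms_le_reducible T (Tr_mem_linearForms A)
      · exact hT C A hC hA
    | zero => simp
    | add a b _ _ ha hb => rw [add_mul]; exact add_mem ha hb
    | smul a b _ hb => rw [smul_mul_assoc]; exact Submodule.smul_mem _ _ hb
  refine eq_top_iff.2 fun q _ => ?_
  induction q using MvPolynomial.induction_on with
  | C a =>
    have := mul_mem_of_mem_R ((R F m).algebraMap_mem a)
      (linearForms_le_reducible T one_mem_linearForms)
    rwa [mul_one] at this
  | add p q hp hq => exact add_mem (hp trivial) (hq trivial)
  | mul_X p g hp =>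
    cases g with
    | x i => rw [mul_comm]; exact mul_mem_of_mem_R (x_mem_R i) (hp trivial)
    | N i => rw [mul_comm]; exact mul_mem_of_mem_R (N_mem_R i) (hp trivial)
    | Tr A =>
      have := hTr A.1 A.2 p (hp trivial)
      rwa [Tr, dif_pos A.2] at this

/-- The relations of type III rewrite `Tr(A) Tr(B)` in terms of products in which the smaller
of the two sets has become strictly smaller, so the rewriting ends in a linear form. -/
theorem Tr_mul_Tr_mem_reducible {r : Sym2 {A : Finset (Fin m) // 2 ≤ A.card} → Q F m}
    (hr : IsChoice r) (A B : Finset (Fin m)) :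
    Tr F A * Tr F B ∈ reducible (Set.range r) := by
  obtain ⟨n, hn⟩ : ∃ n, min A.card B.card < n := ⟨_, Nat.lt_succ_self _⟩
  induction n generalizing A B with
  | zero => omega
  | succ n ih =>
  by_cases hA : 2 ≤ A.card
  swap
  · exact mul_mem_of_mem_R (Tr_mem_R hA) (linearForms_le_reducible _ (Tr_mem_linearForms B))
  by_cases hB : 2 ≤ B.card
  swap
  · rw [mul_comm]
    exact mul_mem_of_mem_R (Tr_mem_R hB) (linearForms_le_reducible _ (Tr_mem_linearForms A))
  obtain ⟨⟨A', hA'⟩, ⟨B', hB'⟩, hp, h⟩ := hr s(⟨A, hA⟩, ⟨B, hB⟩)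
  have hmem := mem_reducible_of_mem (Ideal.subset_span (Set.mem_range_self s(⟨A, hA⟩, ⟨B, hB⟩)))
    (T := Set.range r)
  generalize r s(⟨A, hA⟩, ⟨B, hB⟩) = q at h hmem
  suffices H : Tr F A' * Tr F B' ∈ reducible (Set.range r) by
    simp only [Sym2.eq_iff, Subtype.mk.injEq] at hp
    obtain ⟨rfl, rfl⟩ | ⟨rfl, rfl⟩ := hp
    · exact H
    · rwa [mul_comm]
  replace hn : min A'.card B'.card < n + 1 := by
    simp only [Sym2.eq_iff, Subtype.mk.injEq] at hp
    obtain ⟨rfl, rfl⟩ | ⟨rfl, rfl⟩ := hp <;> omega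
  clear hp hA hB A B
  have hlin := fun C => linearForms_le_reducible (Set.range r) (Tr_mem_linearForms (F := F) C)
  cases h with
  | a j hAB hcard hj =>
    dsimp only at *
    have hc := Finset.card_erase_lt_of_mem hj
    have h1 := ih (insert j A') (B'.erase j) (by omega)
    have h2 := mul_mem_of_mem_R (x_mem_R j) (hlin (A' ∪ B'.erase j))
    have h3 := mul_mem_of_mem_R (x_mem_R j) (ih A' (B'.erase j) (by omega))
    convert sub_mem (sub_mem (sub_mem hmem h1) h2) h3 using 1
    rw [typeIIIa]; ring
  | b i hAB hBA hi =>
    dsimp only at *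
    have hiB := (Finset.mem_inter.1 hi).2
    have hc := Finset.card_erase_lt_of_mem hiB
    have hc' := Finset.card_le_card hBA
    have h1 := mul_mem_of_mem_R (x_mem_R i) (ih A' (B'.erase i) (by omega))
    have h2 := mul_mem_of_mem_R (N_mem_R i) (ih (A'.erase i) (B'.erase i) (by omega))
    have h3 := mul_mem_of_mem_R (x_mem_R i) (mul_mem_of_mem_R
      (NPow_mem_R (B'.erase i)) (hlin (insert i (A' \ B'))))
    convert sub_mem (sub_mem (sub_mem hmem h1) h2) h3 using 1
    rw [typeIIIb]; ring
  | c hAB hA hB =>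
    dsimp only at *
    have hc : (A' ∩ B').card < A'.card := Finset.card_lt_card
      ⟨Finset.inter_subset_left, fun h => hA (h.trans Finset.inter_subset_right)⟩
    have hc' : (A' ∩ B').card < B'.card := Finset.card_lt_card
      ⟨Finset.inter_subset_right, fun h => hB (h.trans Finset.inter_subset_left)⟩
    have hd := Finset.card_inter_add_card_sdiff A' B'
    have hd' := Finset.card_inter_add_card_sdiff B' A'
    rw [Finset.inter_comm B' A'] at hd'
    have hpos := hAB.card_pos
    have h1 := ih (A' ∪ B') (A' ∩ B') (by omega)
    have h2 := mul_mem_of_mem_R (NPow_mem_R (A' ∩ B'))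
      (ih (A' \ B') (B' \ A') (by omega))
    convert sub_mem (sub_mem hmem h1) h2 using 1
    rw [typeIIIc]; ring

theorem IsChoice.reducible_eq_top {r : Sym2 {A : Finset (Fin m) // 2 ≤ A.card} → Q F m}
    (hr : IsChoice r) : reducible (Set.range r) = ⊤ :=
  VectorInvariants.reducible_eq_top fun A B _ _ => Tr_mul_Tr_mem_reducible hr A B

variable [CharP F 2]

theorem relations_le {T : Set (Q F m)} (hT : T ⊆ relations F m) (h : reducible T = ⊤) :
    (relations F m).restrictScalars (R F m) ≤
      (Ideal.span T).restrictScalars (R F m) ⊔ linearRelations F m := by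
  intro q hq
  obtain ⟨t, ht, l, hl, rfl⟩ := Submodule.mem_sup.1 (h ▸ trivial : q ∈ reducible T)
  exact Submodule.add_mem_sup ht
    ⟨hl, ((relations F m).add_mem_iff_right (Ideal.span_le.2 hT ht)).1 hq⟩

/-- A set generating the quadratic relations reduces every element of `Q` to a linear form,
provided that every product `Tr(A) Tr(B)` occurs in some quadratic relation. -/
theorem GeneratesQuadratic.reducible_eq_top {T : Set (Q F m)} (hT : GeneratesQuadratic T)
    (h : ∀ A B : Finset (Fin m), 2 ≤ A.card → 2 ≤ B.card →
      ∃ l ∈ linearForms F m, Tr F A * Tr F B + l ∈ relations F m) :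
    reducible T = ⊤ := by
  refine VectorInvariants.reducible_eq_top fun A B hA hB => ?_
  obtain ⟨l, hl, hAB⟩ := h A B hA hB
  have hmem := (sup_le_sup_left inf_le_left _ : _ ≤ reducible T)
    (hT.2 ⟨hAB, A, B, hA, hB, by simpa using hl⟩)
  exact (Submodule.add_mem_iff_left _ (linearForms_le_reducible T hl)).1 hmem

theorem IsChoice.range_subset {r : Sym2 {A : Finset (Fin m) // 2 ≤ A.card} → Q F m}
    (hr : IsChoice r) : Set.range r ⊆ relations F m := by
  rintro _ ⟨p, rfl⟩
  obtain ⟨A, B, -, h⟩ := hr p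
  exact h.mem_relations

theorem IsChoice.generatesQuadratic {r : Sym2 {A : Finset (Fin m) // 2 ≤ A.card} → Q F m}
    (hr : IsChoice r) : GeneratesQuadratic (Set.range r) :=
  ⟨hr.range_subset, fun _ hq => relations_le hr.range_subset hr.reducible_eq_top hq.1⟩

theorem IsChoice.exists_quadratic {r : Sym2 {A : Finset (Fin m) // 2 ≤ A.card} → Q F m}
    (hr : IsChoice r) (A B : Finset (Fin m)) :
    ∃ l ∈ linearForms F m, Tr F A * Tr F B + l ∈ relations F m := by
  obtain ⟨t, ht, l, hl, h⟩ := Submodule.mem_sup.1 (Tr_mul_Tr_mem_reducible hr A B)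
  refine ⟨-l, neg_mem hl, ?_⟩
  rw [← h, add_neg_cancel_right]
  exact Ideal.span_le.2 hr.range_subset ht

end

/-! ### Freeness of `F[m V₂]` over the coefficient ring -/

section

/-- The inclusion of the coefficient ring `R`, presented as an abstract polynomial ring in the
variables `xᵢ` and `Nᵢ` (the latter named `yᵢ`), into `Q`. -/
def coeffMap (F : Type*) [Field F] (m : ℕ) : CoordRing F m →ₐ[F] Q F m :=
  aeval fun c => match c with
    | Coord.x i => x F i
    | Coord.y i => N F i

@[simp]
theorem coeffMap_x (i : Fin m) : coeffMap F m (X (Coord.x i)) = x F i := by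
  simp [coeffMap]

@[simp]
theorem coeffMap_y (i : Fin m) : coeffMap F m (X (Coord.y i)) = N F i := by
  simp [coeffMap]

theorem exists_coeffMap_eq {q : Q F m} (hq : q ∈ R F m) : ∃ p, coeffMap F m p = q := by
  suffices h : R F m ≤ (coeffMap F m).range from h hq
  refine Algebra.adjoin_le ?_
  rintro _ (⟨i, rfl⟩ | ⟨i, rfl⟩)
  · exact ⟨_, coeffMap_x i⟩
  · exact ⟨_, coeffMap_y i⟩

/-- The substitution `y_a ↦ y_a + x_a` in one index `a`. -/
def sigmaAt (F : Type*) [Field F] {m : ℕ} (a : Fin m) : CoordRing F m →ₐ[F] CoordRing F m :=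
  aeval fun c => match c with
    | Coord.x i => X (Coord.x i)
    | Coord.y i => if i = a then X (Coord.y i) + X (Coord.x i) else X (Coord.y i)

theorem sigmaAt_yPow {a : Fin m} {A : Finset (Fin m)} (h : a ∉ A) :
    sigmaAt F a (yPow F A) = yPow F A := by
  rw [yPow, map_prod]
  refine Finset.prod_congr rfl fun i hi => ?_
  simp [sigmaAt, show i ≠ a from fun e => h (e ▸ hi)]

variable [CharP F 2]

/-- The elements `xᵢ` and `Nᵢ` of `F[m V₂]` are algebraically independent: over a field containing
independent `xᵢ`, `nᵢ`, the equations `yᵢ² + xᵢ yᵢ = nᵢ` can be solved, and evaluation at the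
solutions recovers every polynomial in `xᵢ`, `nᵢ`. -/
theorem piVal_coeffMap_injective :
    Function.Injective ((piVal F m).comp (coeffMap F m)) := by
  let K := AlgebraicClosure (FractionRing (CoordRing F m))
  have hinj : Function.Injective (algebraMap (CoordRing F m) K) := by
    rw [IsScalarTower.algebraMap_eq (CoordRing F m) (FractionRing (CoordRing F m)) K]
    exact (algebraMap (FractionRing (CoordRing F m)) K).injective.comp
      (IsFractionRing.injective _ _)
  let e (c : Coord m) : K := algebraMap (CoordRing F m) K (X c)
  have hroot (i : Fin m) : ∃ t : K, t ^ 2 + e (Coord.x i) * t = e (Coord.y i) := by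
    have hdeg : (Polynomial.X ^ 2 + Polynomial.C (e (Coord.x i)) * Polynomial.X
        - Polynomial.C (e (Coord.y i))).degree = 2 := by compute_degree!
    obtain ⟨t, ht⟩ := IsAlgClosed.exists_root _ (hdeg.trans_ne two_ne_zero)
    exact ⟨t, by simpa [sub_eq_zero] using ht⟩
  choose t ht using hroot
  let ψ : CoordRing F m →ₐ[F] K := aeval fun c => match c with
    | Coord.x i => e (Coord.x i)
    | Coord.y i => t i
  have hψ : ψ.comp ((piVal F m).comp (coeffMap F m)) =
      IsScalarTower.toAlgHom F (CoordRing F m) K := by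
    ext c
    cases c with
    | x i => simp [ψ, e]
    | y i => simp [ψ, norm, ht]; rfl
  refine Function.Injective.of_comp (f := ψ) ?_
  rw [← AlgHom.coe_comp, hψ]
  exact hinj

theorem sigmaAt_piVal_coeffMap (a : Fin m) (p : CoordRing F m) :
    sigmaAt F a (piVal F m (coeffMap F m p)) = piVal F m (coeffMap F m p) := by
  suffices h : (sigmaAt F a).comp ((piVal F m).comp (coeffMap F m)) =
      (piVal F m).comp (coeffMap F m) from congr($h p)
  ext c : 1
  cases c with
  | x i => simp [sigmaAt]
  | y i =>
    by_cases h : i = a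
    · simp only [norm, sigmaAt, AlgHom.coe_comp, Function.comp_apply, coeffMap_y, piVal_N, map_add,
        map_pow, map_mul, aeval_X, h, if_true]
      linear_combination (X (Coord.x a) * X (Coord.y a) + X (Coord.x a) ^ 2 : CoordRing F m) *
        two_eq_zero_coordRing F m
    · simp [sigmaAt, norm, h]

/-- The monomials `y^L` are linearly independent over `F[x₁, …, x_m, N₁, …, N_m]`. The difference
operator of `y_a ↦ y_a + x_a` is linear over that ring and extracts the part divisible by `y_a`. -/
theorem yPow_independent (s : Finset (Fin m)) (f : Finset (Fin m) → CoordRing F m)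
    (h : ∑ L ∈ s.powerset, piVal F m (coeffMap F m (f L)) * yPow F L = 0) :
    ∀ L ⊆ s, f L = 0 := by
  induction s using Finset.induction_on generalizing f with
  | empty =>
    intro L hL
    obtain rfl := Finset.subset_empty.1 hL
    rw [Finset.powerset_empty, Finset.sum_singleton, yPow, Finset.prod_empty, mul_one] at h
    exact piVal_coeffMap_injective (h.trans (map_zero _).symm)
  | insert a s ha ih =>
    have hnot : ∀ L ∈ s.powerset, a ∉ L := fun L hL h => ha (Finset.mem_powerset.1 hL h)
    have hsplit : ∑ L ∈ s.powerset, piVal F m (coeffMap F m (f (insert a L))) * yPow F (insert a L)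
        = X (Coord.y a) *
          ∑ L ∈ s.powerset, piVal F m (coeffMap F m (f (insert a L))) * yPow F L := by
      rw [Finset.mul_sum]
      exact Finset.sum_congr rfl fun L hL => by rw [yPow_insert (hnot L hL)]; ring
    rw [Finset.sum_powerset_insert ha, hsplit] at h
    have hfix (g : Finset (Fin m) → CoordRing F m) :
        sigmaAt F a (∑ L ∈ s.powerset, piVal F m (coeffMap F m (g L)) * yPow F L) =
          ∑ L ∈ s.powerset, piVal F m (coeffMap F m (g L)) * yPow F L := by
      rw [map_sum]
      exact Finset.sum_congr rfl fun L hL => by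
        rw [map_mul, sigmaAt_piVal_coeffMap, sigmaAt_yPow (hnot L hL)]
    -- Both sums are fixed by `sigmaAt a`, so the difference of `h` and its image is `x_a` times the
    -- second sum.
    have h' := congrArg (sigmaAt F a) h
    have hy : sigmaAt F a (X (Coord.y a)) = X (Coord.y a) + X (Coord.x a) := by simp [sigmaAt]
    rw [map_add, map_mul, hfix f, hfix fun L => f (insert a L), hy, map_zero] at h'
    have h1 : ∑ L ∈ s.powerset, piVal F m (coeffMap F m (f (insert a L))) * yPow F L = 0 := by
      refine (mul_eq_zero.1 ?_).resolve_left (X_ne_zero (Coord.x a))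
      linear_combination h' - h
    rw [h1, mul_zero, add_zero] at h
    intro L hL
    by_cases haL : a ∈ L
    · rw [← Finset.insert_erase haL]
      exact ih _ h1 _ (Finset.subset_insert_iff.1 hL)
    · exact ih _ h _ ((Finset.subset_insert_iff_of_notMem haL).1 hL)

end

/-! ### The Koszul complex and linear relations -/

section

/-- The variables `xᵢ` form a regular sequence: if `x_a p` lies in the ideal generated by the `xᵢ`
with `i ∈ s` and `a ∉ s`, then so does `p`. -/
theorem exists_eq_sum_of_X_mul {s : Finset (Fin m)} {a : Fin m} (ha : a ∉ s)
    {p : CoordRing F m} {f : Fin m → CoordRing F m}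
    (h : X (Coord.x a) * p = ∑ i ∈ s, X (Coord.x i) * f i) :
    ∃ c : Fin m → CoordRing F m, p = ∑ i ∈ s, X (Coord.x i) * c i := by
  let I : Ideal (CoordRing F m) := Ideal.span (X '' (Coord.x '' (s : Set (Fin m))))
  have hI : X (Coord.x a) * p ∈ I := by
    rw [h]
    exact sum_mem fun i hi => I.mul_mem_right _
      (Ideal.subset_span ⟨_, ⟨i, hi, rfl⟩, rfl⟩)
  have hp : p ∈ I := by
    rw [mem_ideal_span_X_image] at hI ⊢
    intro d hd
    obtain ⟨_, ⟨i, hi, rfl⟩, hne⟩ := hI (Finsupp.single (Coord.x a) 1 + d) (by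
      rwa [mem_support_iff, coeff_X_mul, ← mem_support_iff])
    refine ⟨_, ⟨i, hi, rfl⟩, ?_⟩
    have hia : Coord.x a ≠ Coord.x i := by rintro ⟨⟩; exact ha hi
    simpa [Finsupp.single_eq_of_ne' hia] using hne
  rw [show I = Ideal.span ((fun i => X (Coord.x i)) '' (s : Set (Fin m))) by
    simp only [I, Set.image_image]] at hp
  obtain ⟨c, hc⟩ := (Submodule.mem_span_image_finset_iff_exists_fun' _).1 hp
  exact ⟨c, by simp_rw [← hc, smul_eq_mul, mul_comm (c _)]⟩

/-- The Koszul differential on the index set `s` of a function `f` on the subsets of `s`,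
evaluated at `L`. No signs are needed in characteristic `2`. -/
def koszul (s : Finset (Fin m)) (f : Finset (Fin m) → CoordRing F m) (L : Finset (Fin m)) :
    CoordRing F m :=
  ∑ i ∈ s \ L, X (Coord.x i) * f (insert i L)

theorem koszul_insert {a : Fin m} {s L : Finset (Fin m)} (ha : a ∉ s) (hL : L ⊆ s)
    (f : Finset (Fin m) → CoordRing F m) :
    koszul (insert a s) f L = X (Coord.x a) * f (insert a L) + koszul s f L := by
  have haL : a ∉ L := fun h => ha (hL h)
  rw [koszul, Finset.insert_sdiff_of_notMem _ haL, Finset.sum_insert (by simp [ha]), koszul]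

theorem koszul_insert_insert {a : Fin m} {s L : Finset (Fin m)} (ha : a ∉ s)
    (f : Finset (Fin m) → CoordRing F m) :
    koszul (insert a s) f (insert a L) = koszul s (fun C => f (insert a C)) L := by
  rw [koszul, Finset.insert_sdiff_insert, Finset.sdiff_insert_of_notMem ha, koszul]
  simp_rw [Finset.insert_comm a]

/-- Exactness of the Koszul complex of the `xᵢ` in positive degrees. -/
theorem exists_eq_koszul [CharP F 2] (s : Finset (Fin m)) (k : ℕ)
    (f : Finset (Fin m) → CoordRing F m)
    (hf : ∀ L ⊆ s, L.card = k → koszul s f L = 0) :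
    ∃ g : Finset (Fin m) → CoordRing F m, ∀ C ⊆ s, C.card = k + 1 → f C = koszul s g C := by
  induction s using Finset.induction_on generalizing k f with
  | empty =>
    refine ⟨0, fun C hC hk => ?_⟩
    rw [Finset.subset_empty.1 hC] at hk
    simp at hk
  | insert a s ha ih =>
    have hsub {C : Finset (Fin m)} (hC : C ⊆ s) : C ⊆ insert a s :=
      hC.trans (Finset.subset_insert a s)
    -- The cycle `f` splits into a cycle `f(a ∪ ·)` of degree one less for `s`, and the rest.
    -- The former is the boundary of some `g₁`; in degree `0` this is the regularity of `x_a`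
    -- modulo the `xᵢ` with `i ∈ s`.
    obtain ⟨g₁, hg₁⟩ : ∃ g₁ : Finset (Fin m) → CoordRing F m,
        ∀ C ⊆ s, C.card = k → f (insert a C) = koszul s g₁ C := by
      cases k with
      | zero =>
        have h := hf ∅ (Finset.empty_subset _) rfl
        rw [koszul_insert ha (Finset.empty_subset s)] at h
        obtain ⟨c, hc⟩ := exists_eq_sum_of_X_mul (f := fun i => -f {i}) ha
          (show X (Coord.x a) * f (insert a ∅) = _ by
            rw [koszul, Finset.sdiff_empty] at h
            simpa [Finset.sum_neg_distrib] using eq_neg_of_add_eq_zero_left h)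
        refine ⟨fun C => ∑ i ∈ C, c i, fun C _ hC => ?_⟩
        obtain rfl := Finset.card_eq_zero.1 hC
        simpa [koszul] using hc
      | succ k =>
        refine ih k (fun C => f (insert a C)) fun L hL hk => ?_
        rw [← koszul_insert_insert ha]
        exact hf _ (Finset.insert_subset_insert a hL)
          (by rw [Finset.card_insert_of_notMem fun h => ha (hL h), hk])
    -- Adding `x_a g₁` makes the remaining part a cycle for `s`.
    obtain ⟨g₀, hg₀⟩ := ih k (fun C => f C + X (Coord.x a) * g₁ C) fun L hL hk => by
      have h := hf L (hsub hL) hk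
      rw [koszul_insert ha hL, hg₁ L hL hk] at h
      rw [← h, koszul, koszul, koszul, Finset.mul_sum, ← Finset.sum_add_distrib]
      exact Finset.sum_congr rfl fun i _ => by ring
    refine ⟨fun D => if a ∈ D then g₁ (D.erase a) else g₀ D, fun C hC hk => ?_⟩
    by_cases haC : a ∈ C
    · obtain ⟨D, haD, rfl⟩ : ∃ D, a ∉ D ∧ C = insert a D :=
        ⟨C.erase a, Finset.notMem_erase a C, (Finset.insert_erase haC).symm⟩
      have hD : D ⊆ s := (Finset.insert_subset_insert_iff haD).1 hC
      rw [Finset.card_insert_of_notMem haD] at hk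
      rw [koszul_insert_insert ha, hg₁ D hD (by omega)]
      refine Finset.sum_congr rfl fun i hi => ?_
      have hia : a ≠ i := fun h => ha (h ▸ (Finset.mem_sdiff.1 hi).1)
      simp [haD, hia]
    · have hCs : C ⊆ s := (Finset.subset_insert_iff_of_notMem haC).1 hC
      have h0 : koszul s (fun D => if a ∈ D then g₁ (D.erase a) else g₀ D) C = koszul s g₀ C := by
        refine Finset.sum_congr rfl fun i hi => ?_
        have hia : a ≠ i := fun h => ha (h ▸ (Finset.mem_sdiff.1 hi).1)
        simp [haC, hia]
      have h := hg₀ C hCs hk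
      rw [koszul_insert ha hCs, h0, ← h]
      simp only [Finset.mem_insert_self, if_true, Finset.erase_insert haC]
      linear_combination -(X (Coord.x a) * g₁ C) * two_eq_zero_coordRing F m

/-- The element `∑_{C ⊃ L} f_C x^{C - L}`: the coefficient of `y^L` in `∑ f_C tr(C)`. -/
def upperSum (f : Finset (Fin m) → CoordRing F m) (L : Finset (Fin m)) : CoordRing F m :=
  ∑ C with L ⊂ C, f C * ∏ i ∈ C \ L, X (Coord.x i)

theorem sum_mul_sum_ssubsets {S : Type*} [CommRing S] [Algebra F S] (φ : CoordRing F m →ₐ[F] S)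
    (t : Finset (Fin m) → S) (f : Finset (Fin m) → CoordRing F m) :
    ∑ C, φ (f C) * ∑ L ∈ C.ssubsets, φ (∏ i ∈ C \ L, X (Coord.x i)) * t L =
      ∑ L, φ (upperSum f L) * t L := by
  simp_rw [upperSum, map_sum, Finset.mul_sum, Finset.sum_mul, map_mul, mul_assoc]
  exact Finset.sum_comm' (by simp)

theorem upperSum_eq_koszul {f : Finset (Fin m) → CoordRing F m} {L : Finset (Fin m)}
    (hf : ∀ C, L.card + 1 < C.card → f C = 0) : upperSum f L = koszul Finset.univ f L := by
  have himage : (Finset.univ \ L).image (fun i => insert i L) ⊆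
      Finset.univ.filter fun C => L ⊂ C := by
    intro C hC
    obtain ⟨i, hi, rfl⟩ := Finset.mem_image.1 hC
    simpa using Finset.ssubset_insert (Finset.mem_sdiff.1 hi).2
  rw [upperSum, ← Finset.sum_subset himage, Finset.sum_image, koszul]
  · refine Finset.sum_congr rfl fun i hi => ?_
    have hiL := (Finset.mem_sdiff.1 hi).2
    rw [Finset.insert_sdiff_cancel hiL, Finset.prod_singleton, mul_comm]
  · intro i hi j hj hij
    exact (Finset.insert_inj (by simpa using hi)).1 hij
  · intro C hC hnot
    have hLC : L ⊂ C := by simpa using hC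
    rw [hf C, zero_mul]
    have hlt := Finset.card_lt_card hLC
    refine lt_of_le_of_ne hlt fun hcard => hnot ?_
    obtain ⟨i, hi⟩ := Finset.card_eq_one.1 (show (C \ L).card = 1 by
      rw [Finset.card_sdiff_of_subset hLC.1]; omega)
    have hiL : i ∉ L := (Finset.mem_sdiff.1 (hi ▸ Finset.mem_singleton_self i : i ∈ C \ L)).2
    refine Finset.mem_image.2 ⟨i, by simpa using hiL, ?_⟩
    rw [Finset.insert_eq, ← hi, Finset.sdiff_union_of_subset hLC.1]

theorem typeI_eq (A : Finset (Fin m)) : typeI F A =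
    ∑ L ∈ A.ssubsets, coeffMap F m (∏ i ∈ A \ L, X (Coord.x i)) * Tr F L := by
  rw [typeI, Finset.sum_filter]
  refine Finset.sum_congr rfl fun L _ => ?_
  split_ifs with hL
  · simp [xPow, map_prod]
  · rw [Finset.not_nonempty_iff_eq_empty.1 hL, Tr_empty, mul_zero]

theorem exists_eq_sum_of_mem_linearForms {l : Q F m} (hl : l ∈ linearForms F m) :
    ∃ (f₀ : CoordRing F m) (f : Finset (Fin m) → CoordRing F m),
      l = coeffMap F m f₀ + ∑ C, coeffMap F m (f C) * Tr F C := by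
  classical
  induction hl using Submodule.span_induction with
  | mem l hl =>
    obtain rfl | ⟨C, -, rfl⟩ := hl
    · exact ⟨1, 0, by simp⟩
    · refine ⟨0, fun D => if D = C then 1 else 0, ?_⟩
      simp [apply_ite (coeffMap F m), ite_mul]
  | zero => exact ⟨0, 0, by simp⟩
  | add a b _ _ ha hb =>
    obtain ⟨f₀, f, rfl⟩ := ha
    obtain ⟨g₀, g, rfl⟩ := hb
    refine ⟨f₀ + g₀, f + g, ?_⟩
    simp only [Pi.add_apply, map_add, add_mul, Finset.sum_add_distrib]
    ring
  | smul a b _ hb =>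
    obtain ⟨f₀, f, rfl⟩ := hb
    obtain ⟨p, hp⟩ := exists_coeffMap_eq a.2
    refine ⟨p * f₀, fun C => p * f C, ?_⟩
    simp only [map_mul, hp, Subalgebra.smul_def, smul_eq_mul, mul_add, Finset.mul_sum, mul_assoc]

variable [CharP F 2]

theorem tr_eq_sum (C : Finset (Fin m)) :
    tr F C = ∑ L ∈ C.ssubsets, (∏ i ∈ C \ L, X (Coord.x i)) * yPow F L := by
  have hz : zPow F C = ∑ L ∈ C.powerset, yPow F L * ∏ i ∈ C \ L, X (Coord.x i) :=
    Finset.prod_add _ _ _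
  rw [tr_eq, hz, ← Finset.add_sum_erase _ _ (Finset.mem_powerset_self C), Finset.sdiff_self,
    Finset.prod_empty, mul_one, ← add_assoc, CharTwo.add_self_eq_zero, zero_add, Finset.ssubsets]
  simp_rw [mul_comm]

/-- In a linear relation `f₀ + ∑ f_C Tr(C)` the coefficient of each `y^L`, `L ≠ ∅`, in the
image under `π` vanishes. -/
theorem upperSum_eq_zero {f₀ : CoordRing F m} {f : Finset (Fin m) → CoordRing F m}
    (h : coeffMap F m f₀ + ∑ C, coeffMap F m (f C) * Tr F C ∈ relations F m)
    {L : Finset (Fin m)} (hL : L.Nonempty) : upperSum f L = 0 := by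
  have htr (C : Finset (Fin m)) : tr F C = ∑ L ∈ C.ssubsets,
      (piVal F m).comp (coeffMap F m) (∏ i ∈ C \ L, X (Coord.x i)) * yPow F L := by
    simp [tr_eq_sum, map_prod]
  have h' : ∑ L, piVal F m (coeffMap F m ((if L = ∅ then f₀ else 0) + upperSum f L)) * yPow F L
      = 0 := by
    rw [mem_relations, map_add, map_sum] at h
    simp_rw [map_mul, piVal_Tr, htr] at h
    have hsum := sum_mul_sum_ssubsets ((piVal F m).comp (coeffMap F m)) (yPow F) f
    simp only [AlgHom.comp_apply] at hsum h
    rw [hsum] at h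
    simp only [map_add, add_mul, Finset.sum_add_distrib]
    refine Eq.trans (congrArg (· + _) ?_) h
    rw [Finset.sum_eq_single ∅]
    · simp [yPow]
    · intro L _ hL
      simp [hL]
    · simp
  rw [← Finset.powerset_univ] at h'
  simpa [hL.ne_empty] using yPow_independent Finset.univ _ h' L (Finset.subset_univ L)

/-- The linear relations are generated by those of type I. The coefficients `f_C` with `|C|` maximal
form a Koszul cycle; it is a boundary, and so it is the leading part of a combination of type I
relations, whose leading coefficients are the Koszul differential. -/
theorem mem_span_typeI (k : ℕ) (f₀ : CoordRing F m) (f : Finset (Fin m) → CoordRing F m)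
    (hf : ∀ C, k + 1 < C.card → f C = 0)
    (h : coeffMap F m f₀ + ∑ C, coeffMap F m (f C) * Tr F C ∈ relations F m) :
    coeffMap F m f₀ + ∑ C, coeffMap F m (f C) * Tr F C ∈ Ideal.span (typeISet F m) := by
  induction k generalizing f with
  | zero =>
    obtain ⟨p, hp⟩ : ∃ p, coeffMap F m p =
        coeffMap F m f₀ + ∑ C, coeffMap F m (f C) * Tr F C := by
      suffices H : coeffMap F m f₀ + ∑ C, coeffMap F m (f C) * Tr F C ∈ (coeffMap F m).range from H
      refine add_mem ⟨f₀, rfl⟩ (sum_mem fun C _ => ?_)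
      by_cases hC : 2 ≤ C.card
      · simp [hf C (by omega)]
      · exact mul_mem ⟨f C, rfl⟩ (exists_coeffMap_eq (Tr_mem_R hC))
    rw [← hp] at h ⊢
    have : p = 0 := piVal_coeffMap_injective ((mem_relations.1 h).trans (map_zero _).symm)
    simp [this]
  | succ k ih =>
    obtain ⟨g, hg⟩ := exists_eq_koszul Finset.univ (k + 1) f fun L _ hL => by
      rw [← upperSum_eq_koszul fun C hC => hf C (by omega)]
      exact upperSum_eq_zero h (Finset.card_pos.1 (by omega))
    -- Only the values of `g` in degree `k + 3` serve as coefficients; the Koszul condition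
    -- leaves the others unconstrained.
    let g' (A : Finset (Fin m)) : CoordRing F m := if A.card = k + 3 then g A else 0
    have hmem : ∑ A, coeffMap F m (g' A) * typeI F A ∈ Ideal.span (typeISet F m) := by
      refine sum_mem fun A _ => ?_
      by_cases hA : A.card = k + 3
      · exact Ideal.mul_mem_left _ _ (Ideal.subset_span ⟨A, by omega, rfl⟩)
      · simp [g', hA]
    have hsum : coeffMap F m f₀ + ∑ C, coeffMap F m (f C - upperSum g' C) * Tr F C =
        coeffMap F m f₀ + ∑ C, coeffMap F m (f C) * Tr F C
          - ∑ A, coeffMap F m (g' A) * typeI F A := by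
      simp_rw [typeI_eq, sum_mul_sum_ssubsets, map_sub, sub_mul, Finset.sum_sub_distrib]
      ring
    have hspan : Ideal.span (typeISet F m) ≤ relations F m := by
      refine Ideal.span_le.2 ?_
      rintro _ ⟨A, -, rfl⟩
      exact typeI_mem A
    refine (Submodule.sub_mem_iff_left _ hmem).1 ?_
    rw [← hsum]
    refine ih _ (fun C hC => ?_) ?_
    · rw [upperSum_eq_koszul fun A hA => if_neg (by omega)]
      have hins (i : Fin m) (hi : i ∈ Finset.univ \ C) : (insert i C).card = C.card + 1 :=
        Finset.card_insert_of_notMem (Finset.mem_sdiff.1 hi).2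
      obtain hC | hC : C.card = k + 2 ∨ k + 2 < C.card := by omega
      · rw [hg C (Finset.subset_univ C) hC, sub_eq_zero]
        exact Finset.sum_congr rfl fun i hi => by simp [hins i hi, hC]
      · rw [hf C hC, zero_sub, neg_eq_zero]
        refine Finset.sum_eq_zero fun i hi => ?_
        have : (insert i C).card ≠ k + 3 := by rw [hins i hi]; omega
        simp [this]
    · rw [hsum]
      exact sub_mem h (hspan hmem)

theorem linearRelations_le_span_typeI {q : Q F m} (hq : q ∈ linearRelations F m) :
    q ∈ Ideal.span (typeISet F m) := by
  obtain ⟨f₀, f, rfl⟩ := exists_eq_sum_of_mem_linearForms hq.1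
  refine mem_span_typeI m f₀ f (fun C hC => ?_) hq.2
  have := card_finset_fin_le C
  omega

/-- A set of relations modulo which every element of `Q` reduces to a linear form generates
`ker π` together with the relations of type I. -/
theorem span_union_typeISet {T : Set (Q F m)} (hT : T ⊆ relations F m) (h : reducible T = ⊤) :
    Ideal.span (T ∪ typeISet F m) = relations F m := by
  refine le_antisymm (Ideal.span_le.2 (Set.union_subset hT ?_)) fun q hq => ?_
  · rintro _ ⟨A, -, rfl⟩
    exact typeI_mem A
  · obtain ⟨t, ht, l, hl, rfl⟩ := Submodule.mem_sup.1 (relations_le hT h hq)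
    rw [Ideal.span_union]
    exact Submodule.add_mem_sup ht (linearRelations_le_span_typeI hl)

end

/-! ### Coefficients of quadratic monomials -/

section

theorem coeff_X_mul_X {σ : Type*} [DecidableEq σ] (g g' h h' : σ) :
    coeff (Finsupp.single g 1 + Finsupp.single g' 1) (X h * X h' : MvPolynomial σ F) =
      if h = g ∧ h' = g' ∨ h = g' ∧ h' = g then 1 else 0 := by
  rw [X, X, monomial_mul, coeff_monomial, mul_one]
  refine if_congr ?_ rfl rfl
  rw [Finsupp.single_add_single_eq_single_add_single one_ne_zero one_ne_zero]
  simp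

theorem coeff_eq_zero_of_mem_span {σ : Type*} {E : Set (σ →₀ ℕ)} {d : σ →₀ ℕ}
    {p : MvPolynomial σ F} (hp : p ∈ Ideal.span ((fun e => monomial e (1 : F)) '' E))
    (hE : ∀ e ∈ E, ¬ e ≤ d) : coeff d p = 0 := by
  by_contra h
  obtain ⟨e, he, hle⟩ := mem_ideal_span_monomial_image.1 hp d (mem_support_iff.2 h)
  exact hE e he hle

/-- On the square of the augmentation ideal, multiplication acts on coefficients of degree `2`
through constant terms. -/
theorem coeff_mul_of_mem_sq {σ : Type*} {p q : MvPolynomial σ F} {d : σ →₀ ℕ}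
    (hp : p ∈ idealOfVars σ F ^ 2) (hd : d.degree = 2) :
    coeff d (q * p) = constantCoeff q * coeff d p := by
  have hq : q - C (constantCoeff q) ∈ idealOfVars σ F ^ 1 := by
    rw [mem_pow_idealOfVars_iff']
    intro e he
    obtain rfl : e = 0 := (Finsupp.degree_eq_zero_iff e).1 (by omega)
    simp [constantCoeff_eq]
  have h := Ideal.mul_mem_mul hq hp
  rw [← pow_add, mem_pow_idealOfVars_iff'] at h
  have := h d (by omega)
  rwa [sub_mul, coeff_sub, coeff_C_mul, sub_eq_zero] at this

/-- An ideal-theoretic dependence among polynomials without terms of degree less than `2` gives a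
linear dependence, over the field, among their parts of degree `2`. -/
theorem exists_linear_dependence {σ ι : Type*} [Fintype ι] {v : ι → MvPolynomial σ F}
    (hv : ∀ i, v i ∈ idealOfVars σ F ^ 2) {i₀ : ι} (h : v i₀ ∈ Ideal.span (v '' {i₀}ᶜ)) :
    ∃ c : ι → F, c i₀ ≠ 0 ∧ ∀ d : σ →₀ ℕ, d.degree = 2 → ∑ i, c i * coeff d (v i) = 0 := by
  classical
  have hset : ({i₀}ᶜ : Set ι) = ((Finset.univ.erase i₀ : Finset ι) : Set ι) := by
    ext; simp
  rw [hset] at h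
  obtain ⟨q, hq⟩ := (Submodule.mem_span_image_finset_iff_exists_fun' _).1 h
  refine ⟨fun i => if i = i₀ then -1 else constantCoeff (q i), by simp, fun d hd => ?_⟩
  rw [← Finset.add_sum_erase _ _ (Finset.mem_univ i₀), ← hq]
  simp only [if_true, coeff_sum, smul_eq_mul, coeff_mul_of_mem_sq (hv _) hd, neg_mul, one_mul]
  rw [neg_add_eq_zero]
  exact Finset.sum_congr rfl fun i hi => by rw [if_neg (Finset.ne_of_mem_erase hi)]

/-! ### The quadratic parts of the relations -/

theorem x_mem_idealOfVars (i : Fin m) : x F i ∈ idealOfVars (Gen m) F :=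
  Ideal.subset_span ⟨_, rfl⟩

theorem Tr_mem_idealOfVars (A : Finset (Fin m)) : Tr F A ∈ idealOfVars (Gen m) F := by
  rw [Tr]
  split_ifs
  · exact Ideal.subset_span ⟨_, rfl⟩
  · exact sum_mem fun i _ => x_mem_idealOfVars i

theorem xPow_mem_of_mem {I : Ideal (Q F m)} {A : Finset (Fin m)} {i : Fin m} (hi : i ∈ A)
    (hx : x F i ∈ I) : xPow F A ∈ I := by
  rw [xPow, ← Finset.mul_prod_erase _ _ hi]
  exact I.mul_mem_right _ hx

theorem mul_mem_sq {p q : Q F m} (hp : p ∈ idealOfVars (Gen m) F)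
    (hq : q ∈ idealOfVars (Gen m) F) : p * q ∈ idealOfVars (Gen m) F ^ 2 := by
  rw [pow_two]
  exact Ideal.mul_mem_mul hp hq

theorem typeI_mem_sq (A : Finset (Fin m)) : typeI F A ∈ idealOfVars (Gen m) F ^ 2 := by
  refine sum_mem fun L hL => ?_
  obtain ⟨hLA, hL⟩ := Finset.mem_filter.1 hL
  obtain ⟨i, hi⟩ := Finset.sdiff_nonempty.2 (Finset.mem_ssubsets.1 hLA).2
  exact mul_mem_sq (xPow_mem_of_mem hi (x_mem_idealOfVars i)) (Tr_mem_idealOfVars L)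

theorem IsTypeIII.mem_sq {A B : Finset (Fin m)} {q : Q F m} (h : IsTypeIII A B q) :
    q ∈ idealOfVars (Gen m) F ^ 2 := by
  have hTr (C D : Finset (Fin m)) := mul_mem_sq (F := F) (Tr_mem_idealOfVars C)
    (Tr_mem_idealOfVars D)
  cases h with
  | a j hAB hcard hj =>
    refine add_mem (add_mem (add_mem (hTr _ _) (hTr _ _)) ?_) ?_
    · exact mul_mem_sq (x_mem_idealOfVars j) (Tr_mem_idealOfVars _)
    · rw [mul_assoc]; exact Ideal.mul_mem_left _ _ (hTr _ _)
  | b i hAB hBA hi =>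
    refine add_mem (add_mem (add_mem (hTr _ _) ?_) ?_) ?_
    · rw [mul_assoc]; exact Ideal.mul_mem_left _ _ (hTr _ _)
    · rw [mul_assoc]; exact Ideal.mul_mem_left _ _ (hTr _ _)
    · exact mul_mem_sq (Ideal.mul_mem_right _ _ (x_mem_idealOfVars i)) (Tr_mem_idealOfVars _)
  | c hAB hA hB =>
    refine add_mem (add_mem (hTr _ _) (hTr _ _)) ?_
    rw [mul_assoc]; exact Ideal.mul_mem_left _ _ (hTr _ _)

/-- The exponents of the monomials `xᵢ`, of the `Nᵢ`, and of the products `Tr(A) Tr(B)` in which one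
of the two sets has fewer than `n` elements. -/
def lowerExponents (m n : ℕ) : Set (Gen m →₀ ℕ) :=
  {e | (∃ i, e = Finsupp.single (Gen.x i) 1) ∨ (∃ i, e = Finsupp.single (Gen.N i) 1) ∨
    ∃ A B : {A : Finset (Fin m) // 2 ≤ A.card}, min A.1.card B.1.card < n ∧
      e = Finsupp.single (Gen.Tr A) 1 + Finsupp.single (Gen.Tr B) 1}

/-- The monomial ideal with exponents `lowerExponents m n`. It contains all terms of a relation of
type III for `{A, B}`, `n = min |A| |B|`, other than `Tr(A) Tr(B)`. -/
def lowerIdeal (F : Type*) [Field F] (m n : ℕ) : Ideal (Q F m) :=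
  Ideal.span ((fun e => monomial e (1 : F)) '' lowerExponents m n)

theorem x_mem_lowerIdeal (n : ℕ) (i : Fin m) : x F i ∈ lowerIdeal F m n :=
  Ideal.subset_span ⟨_, Or.inl ⟨i, rfl⟩, rfl⟩

theorem N_mem_lowerIdeal (n : ℕ) (i : Fin m) : N F i ∈ lowerIdeal F m n :=
  Ideal.subset_span ⟨_, Or.inr (Or.inl ⟨i, rfl⟩), rfl⟩

theorem Tr_mem_lowerIdeal (n : ℕ) {A : Finset (Fin m)} (h : ¬ 2 ≤ A.card) :
    Tr F A ∈ lowerIdeal F m n := by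
  rw [Tr, dif_neg h]
  exact sum_mem fun i _ => x_mem_lowerIdeal n i

theorem Tr_mul_Tr_mem_lowerIdeal {n : ℕ} {A B : Finset (Fin m)} (h : min A.card B.card < n) :
    Tr F A * Tr F B ∈ lowerIdeal F m n := by
  by_cases hA : 2 ≤ A.card
  swap
  · exact Ideal.mul_mem_right _ _ (Tr_mem_lowerIdeal n hA)
  by_cases hB : 2 ≤ B.card
  swap
  · exact Ideal.mul_mem_left _ _ (Tr_mem_lowerIdeal n hB)
  refine Ideal.subset_span ⟨_, Or.inr (Or.inr ⟨⟨A, hA⟩, ⟨B, hB⟩, h, rfl⟩), ?_⟩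
  rw [Tr, Tr, dif_pos hA, dif_pos hB, X, X, monomial_mul, mul_one]

theorem typeI_mem_lowerIdeal (n : ℕ) (A : Finset (Fin m)) : typeI F A ∈ lowerIdeal F m n := by
  refine sum_mem fun L hL => Ideal.mul_mem_right _ _ ?_
  obtain ⟨i, hi⟩ := Finset.sdiff_nonempty.2
    (Finset.mem_ssubsets.1 (Finset.mem_filter.1 hL).1).2
  exact xPow_mem_of_mem hi (x_mem_lowerIdeal n i)

theorem IsTypeIII.sub_mem_lowerIdeal {A B : Finset (Fin m)} {q : Q F m} (h : IsTypeIII A B q) :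
    q - Tr F A * Tr F B ∈ lowerIdeal F m (min A.card B.card) := by
  have hx := x_mem_lowerIdeal (F := F) (m := m) (min A.card B.card)
  cases h with
  | a j hAB hcard hj =>
    have hc := Finset.card_erase_lt_of_mem hj
    rw [show typeIIIa F A B j - Tr F A * Tr F B = Tr F (insert j A) * Tr F (B.erase j) +
      x F j * (Tr F (A ∪ B.erase j) + Tr F A * Tr F (B.erase j)) by rw [typeIIIa]; ring]
    exact add_mem (Tr_mul_Tr_mem_lowerIdeal (by omega)) (Ideal.mul_mem_right _ _ (hx j))
  | b i hAB hBA hi =>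
    rw [show typeIIIb F A B i - Tr F A * Tr F B =
      x F i * (Tr F A * Tr F (B.erase i) + NPow F (B.erase i) * Tr F (insert i (A \ B))) +
      N F i * (Tr F (A.erase i) * Tr F (B.erase i)) by rw [typeIIIb]; ring]
    exact add_mem (Ideal.mul_mem_right _ _ (hx i)) (Ideal.mul_mem_right _ _ (N_mem_lowerIdeal _ i))
  | c hAB hA hB =>
    have hc : (A ∩ B).card < A.card := Finset.card_lt_card
      ⟨Finset.inter_subset_left, fun h => hA (h.trans Finset.inter_subset_right)⟩
    have hc' : (A ∩ B).card < B.card := Finset.card_lt_card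
      ⟨Finset.inter_subset_right, fun h => hB (h.trans Finset.inter_subset_left)⟩
    obtain ⟨i, hi⟩ := hAB
    rw [show typeIIIc F A B - Tr F A * Tr F B = Tr F (A ∪ B) * Tr F (A ∩ B) +
      NPow F (A ∩ B) * (Tr F (A \ B) * Tr F (B \ A)) by rw [typeIIIc]; ring]
    refine add_mem (Tr_mul_Tr_mem_lowerIdeal (by omega)) (Ideal.mul_mem_right _ _ ?_)
    rw [NPow, ← Finset.mul_prod_erase _ _ hi]
    exact Ideal.mul_mem_right _ _ (N_mem_lowerIdeal _ i)

theorem degree_single_add_single {σ : Type*} (g g' : σ) :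
    (Finsupp.single g 1 + Finsupp.single g' 1 : σ →₀ ℕ).degree = 2 := by
  simp

theorem eq_of_le_of_degree_eq {σ : Type*} {e d : σ →₀ ℕ} (h : e ≤ d) (hd : e.degree = d.degree) :
    e = d := by
  obtain ⟨c, rfl⟩ := exists_add_of_le h
  have hc : c = 0 := (Finsupp.degree_eq_zero_iff c).1 (by rw [map_add] at hd; omega)
  rw [hc, add_zero]

theorem coeff_eq_zero_of_mem_lowerIdeal {n : ℕ} {A B : {A : Finset (Fin m) // 2 ≤ A.card}}
    (hn : n ≤ min A.1.card B.1.card) {p : Q F m} (hp : p ∈ lowerIdeal F m n) :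
    coeff (Finsupp.single (Gen.Tr A) 1 + Finsupp.single (Gen.Tr B) 1) p = 0 := by
  refine coeff_eq_zero_of_mem_span hp ?_
  rintro e (⟨i, rfl⟩ | ⟨i, rfl⟩ | ⟨C, D, hCD, rfl⟩) hle
  · simpa [Finsupp.single_apply] using hle (Gen.x i)
  · simpa [Finsupp.single_apply] using hle (Gen.N i)
  · have h := eq_of_le_of_degree_eq hle (by rw [degree_single_add_single, degree_single_add_single])
    rw [Finsupp.single_add_single_eq_single_add_single one_ne_zero one_ne_zero] at h
    simp only [Gen.Tr.injEq] at h
    obtain ⟨rfl, rfl⟩ | ⟨-, rfl, rfl⟩ | ⟨h, -⟩ := h <;> omega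

/-- The quadratic part of the type I relation of `B` is `∑_{k ∈ B} x_k Tr(B - k)`, and each monomial
in it determines `B`. -/
theorem coeff_typeI {A B : Finset (Fin m)} (hB : 3 ≤ B.card) {i : Fin m} (hi : i ∈ A)
    (hA : 2 ≤ (A.erase i).card) :
    coeff (Finsupp.single (Gen.x i) 1 + Finsupp.single (Gen.Tr ⟨A.erase i, hA⟩) 1) (typeI F B) =
      if B = A then 1 else 0 := by
  classical
  have hterm : ∀ L ∈ B.ssubsets.filter (·.Nonempty),
      coeff (Finsupp.single (Gen.x i) 1 + Finsupp.single (Gen.Tr ⟨A.erase i, hA⟩) 1)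
        (xPow F (B \ L) * Tr F L) = if L = A.erase i then (if B = A then 1 else 0) else 0 := by
    intro L hL
    have hLB := Finset.mem_ssubsets.1 (Finset.mem_filter.1 hL).1
    have hcard := Finset.card_sdiff_add_card_eq_card hLB.1
    obtain ⟨k, hk⟩ := Finset.sdiff_nonempty.2 hLB.2
    -- A term with `|B - L| ≥ 2` is divisible by some `x_k x_l`, which does not
    -- divide `x_i Tr(A - i)`.
    by_cases hone : (B \ L).card = 1
    · obtain ⟨k, hk⟩ := Finset.card_eq_one.1 hone
      have hBL : B = insert k L := by
        rw [Finset.insert_eq, ← hk, Finset.sdiff_union_of_subset hLB.1]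
      have hkL : k ∉ L := (Finset.mem_sdiff.1 (hk ▸ Finset.mem_singleton_self k : k ∈ B \ L)).2
      have hL2 : 2 ≤ L.card := by omega
      rw [hk, xPow, Finset.prod_singleton, x, Tr, dif_pos hL2, coeff_X_mul_X, ← ite_and]
      refine if_congr ?_ rfl rfl
      simp only [Gen.x.injEq, Gen.Tr.injEq, Subtype.mk.injEq, reduceCtorEq, and_self, or_false]
      constructor
      · rintro ⟨rfl, rfl⟩
        exact ⟨rfl, by rw [hBL, Finset.insert_erase hi]⟩
      · rintro ⟨rfl, rfl⟩
        refine ⟨?_, rfl⟩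
        by_contra hki
        exact hkL (Finset.mem_erase.2 ⟨hki, hBL ▸ Finset.mem_insert_self _ _⟩)
    · obtain ⟨l, hl, hlk⟩ : ∃ l ∈ B \ L, l ≠ k :=
        Finset.exists_mem_ne (by have := Finset.card_pos.2 ⟨k, hk⟩; omega) k
      have hmem : xPow F (B \ L) * Tr F L ∈ Ideal.span ((fun e => monomial e (1 : F)) ''
          {Finsupp.single (Gen.x k) 1 + Finsupp.single (Gen.x l) 1}) := by
        rw [xPow, ← Finset.mul_prod_erase _ _ hk,
          ← Finset.mul_prod_erase _ _ (Finset.mem_erase.2 ⟨hlk, hl⟩), ← mul_assoc]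
        refine Ideal.mul_mem_right _ _ (Ideal.mul_mem_right _ _ (Ideal.subset_span ?_))
        exact ⟨_, rfl, by rw [x, x, X, X, monomial_mul, mul_one]⟩
      rw [coeff_eq_zero_of_mem_span hmem, ← ite_and, if_neg]
      · rintro ⟨rfl, rfl⟩
        rw [Finset.card_erase_of_mem hi] at hcard
        omega
      · rintro e rfl hle
        have h := eq_of_le_of_degree_eq hle
          (by rw [degree_single_add_single, degree_single_add_single])
        rw [Finsupp.single_add_single_eq_single_add_single one_ne_zero one_ne_zero] at h
        simp at h
  rw [typeI, coeff_sum, Finset.sum_congr rfl hterm, Finset.sum_ite_eq']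
  by_cases hBA : B = A
  · subst hBA
    rw [if_pos rfl, if_pos]
    exact Finset.mem_filter.2
      ⟨Finset.mem_ssubsets.2 (Finset.erase_ssubset hi), Finset.card_pos.1 (by omega)⟩
  · simp [hBA]

/-! ### Minimality -/

/-- The chosen relations of type III together with those of type I, as one family. -/
def relationFamily (r : Sym2 {A : Finset (Fin m) // 2 ≤ A.card} → Q F m) :
    Sym2 {A : Finset (Fin m) // 2 ≤ A.card} ⊕ {A : Finset (Fin m) // 3 ≤ A.card} → Q F m :=
  Sum.elim r fun A => typeI F A.1

theorem range_relationFamily (r : Sym2 {A : Finset (Fin m) // 2 ≤ A.card} → Q F m) :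
    Set.range (relationFamily r) = Set.range r ∪ typeISet F m := by
  rw [relationFamily, Set.Sum.elim_range]
  congr 1
  ext q
  simp [typeISet, eq_comm]

/-- No relation of the family is in the ideal generated by the others. The quadratic parts are
linearly independent: those of type III are triangular with respect to `min |A| |B|` in the
monomials `Tr(A) Tr(B)`, which do not occur in type I, and the quadratic parts of type I have
disjoint supports. -/
theorem IsChoice.notMem_span {r : Sym2 {A : Finset (Fin m) // 2 ≤ A.card} → Q F m}
    (hr : IsChoice r)
    (i₀ : Sym2 {A : Finset (Fin m) // 2 ≤ A.card} ⊕ {A : Finset (Fin m) // 3 ≤ A.card}) :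
    relationFamily r i₀ ∉ Ideal.span (relationFamily r '' {i₀}ᶜ) := by
  classical
  intro hmem
  choose a b hab h using hr
  obtain ⟨c, hc₀, hc⟩ := exists_linear_dependence (v := relationFamily r) (by
    rintro (p | A)
    · exact (h p).mem_sq
    · exact typeI_mem_sq A.1) hmem
  simp only [Fintype.sum_sum_type, relationFamily, Sum.elim_inl, Sum.elim_inr] at hc
  let w (p : Sym2 {A : Finset (Fin m) // 2 ≤ A.card}) : ℕ := min (a p).1.card (b p).1.card
  have hcoeff (p q : Sym2 {A : Finset (Fin m) // 2 ≤ A.card}) (hw : w q ≤ w p) :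
      coeff (Finsupp.single (Gen.Tr (a p)) 1 + Finsupp.single (Gen.Tr (b p)) 1) (r q) =
        if q = p then 1 else 0 := by
    rw [← sub_add_cancel (r q) (Tr F (a q).1 * Tr F (b q).1), coeff_add,
      coeff_eq_zero_of_mem_lowerIdeal hw (h q).sub_mem_lowerIdeal, zero_add, Tr, Tr,
      dif_pos (a q).2, dif_pos (b q).2, coeff_X_mul_X]
    refine if_congr ?_ rfl rfl
    conv_rhs => rw [hab q, hab p, Sym2.eq_iff]
    simp
  have hIII : ∀ p, c (Sum.inl p) = 0 := by
    by_contra! hne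
    -- For `p` of maximal weight, `r p` is the only term in which the monomial of `p` occurs.
    obtain ⟨p, hp, hmax⟩ := Finset.exists_max_image {p | c (Sum.inl p) ≠ 0} w
      (by simpa [Finset.Nonempty] using hne)
    have hsum := hc _ (degree_single_add_single (Gen.Tr (a p)) (Gen.Tr (b p)))
    have hzero (A : {A : Finset (Fin m) // 3 ≤ A.card}) := coeff_eq_zero_of_mem_lowerIdeal
      (F := F) le_rfl (typeI_mem_lowerIdeal (min (a p).1.card (b p).1.card) A.1)
    simp only [hzero, mul_zero, Finset.sum_const_zero, add_zero] at hsum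
    rw [Finset.sum_eq_single p] at hsum
    · rw [hcoeff p p le_rfl, if_pos rfl, mul_one] at hsum
      exact (Finset.mem_filter.1 hp).2 hsum
    · intro q _ hq
      by_cases hcq : c (Sum.inl q) = 0
      · rw [hcq, zero_mul]
      · rw [hcoeff p q (hmax q (by simpa using hcq)), if_neg hq, mul_zero]
    · simp
  have hI : ∀ A, c (Sum.inr A) = 0 := by
    intro A
    obtain ⟨i, hi⟩ := Finset.card_pos.1 (show 0 < A.1.card by have := A.2; omega)
    have hA : 2 ≤ (A.1.erase i).card := by rw [Finset.card_erase_of_mem hi]; have := A.2; omega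
    have hsum := hc _ (degree_single_add_single (Gen.x i) (Gen.Tr ⟨A.1.erase i, hA⟩))
    simp only [hIII, zero_mul, Finset.sum_const_zero, zero_add] at hsum
    rw [Finset.sum_congr rfl fun B _ => by rw [coeff_typeI B.2 hi hA]] at hsum
    simpa [← Subtype.ext_iff] using hsum
  obtain p | A := i₀
  · exact hc₀ (hIII p)
  · exact hc₀ (hI A)

variable [CharP F 2]

theorem IsChoice.span_ne_relations {r : Sym2 {A : Finset (Fin m) // 2 ≤ A.card} → Q F m}
    (hr : IsChoice r) {S : Set (Q F m)}
    {i : Sym2 {A : Finset (Fin m) // 2 ≤ A.card} ⊕ {A : Finset (Fin m) // 3 ≤ A.card}}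
    (hS : S ⊆ relationFamily r '' {i}ᶜ) : Ideal.span S ≠ relations F m := by
  intro hspan
  refine hr.notMem_span i (Ideal.span_mono hS ?_)
  rw [hspan, ← span_union_typeISet hr.range_subset hr.reducible_eq_top, ← range_relationFamily r]
  exact Ideal.subset_span (Set.mem_range_self i)

theorem IsChoice.minimallyGenerates {r : Sym2 {A : Finset (Fin m) // 2 ≤ A.card} → Q F m}
    (hr : IsChoice r) : MinimallyGenerates (Set.range r ∪ typeISet F m) (relations F m) := by
  refine ⟨span_union_typeISet hr.range_subset hr.reducible_eq_top, fun S hS => ?_⟩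
  rw [← range_relationFamily] at hS
  obtain ⟨_, ⟨i, rfl⟩, hi⟩ := Set.exists_of_ssubset hS
  refine hr.span_ne_relations (i := i) fun q hq => ?_
  obtain ⟨k, rfl⟩ := hS.1 hq
  exact ⟨k, fun hk => hi (hk ▸ hq), rfl⟩

/-- If a proper subset of the chosen relations generated the quadratic relations, then, since every
element of `Q` would reduce to a linear form, it would generate `ker π` together with the relations
of type I. -/
theorem IsChoice.minimallyGeneratesQuadratic
    {r : Sym2 {A : Finset (Fin m) // 2 ≤ A.card} → Q F m} (hr : IsChoice r) :
    MinimallyGeneratesQuadratic (Set.range r) := by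
  refine ⟨hr.generatesQuadratic, fun T hT hgen => ?_⟩
  obtain ⟨_, ⟨p, rfl⟩, hp⟩ := Set.exists_of_ssubset hT
  refine hr.span_ne_relations (i := Sum.inl p) (Set.union_subset ?_ ?_) (span_union_typeISet hgen.1
    (hgen.reducible_eq_top fun A B _ _ => hr.exists_quadratic A B))
  · intro q hq
    obtain ⟨k, rfl⟩ := hT.1 hq
    exact ⟨Sum.inl k, fun hk => hp (Sum.inl_injective hk ▸ hq), rfl⟩
  · rintro _ ⟨A, hA, rfl⟩
    exact ⟨Sum.inr ⟨A, hA⟩, Sum.inr_ne_inl, rfl⟩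

end

end VectorInvariants

end

theorem mainTheorem2 (F : Type*) [Field F] [CharP F 2] (m : ℕ)
    (r : Sym2 {A : Finset (Fin m) // 2 ≤ A.card} → VectorInvariants.Q F m)
    (hr : VectorInvariants.IsChoice r) :
    VectorInvariants.MinimallyGeneratesQuadratic (Set.range r) ∧
      VectorInvariants.MinimallyGenerates (Set.range r ∪ VectorInvariants.typeISet F m)
        (VectorInvariants.relations F m) :=
  ⟨hr.minimallyGeneratesQuadratic, hr.minimallyGenerates⟩
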